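/- Let $t\in\mathbb C\setminus\{0,1\}$ and let $a_1,\dots,a_4\in\mathbb C^2$ and $\phi_1,\dots,\phi_4\in\mathbb C^2\otimes\mathbb C^2=\mathbb C^4$ be the columns of $$(a_1,a_2,a_3,a_4)=\begin{pmatrix}1&0&1&t\\0&1&1&1\end{pmatrix},\qquad(\phi_1,\phi_2,\phi_3,\phi_4)=\begin{pmatrix}1&1&0&0\\0&0&1&1\\0&0&1&-1\\1&-1&0&0\end{pmatrix}$$ (bases of tensor products are ordered lexicographically). A three-qubit state is a nonzero positive semidefinite operator on $\mathbb C^2\otimes\mathbb C^2\otimes\mathbb C^2$, not necessarily of trace one; it is separable if it is a convex combination of operators $zz^\dagger$ with $z=x\otimes y\otimes w$ (vectors not necessarily normalized), and entangled otherwise; it is a PPT entangled state (PPTES) if it is entangled and its partial transposes with respect to each of the three qubits are positive semidefinite. For $\lambda_1,\lambda_2,\lambda_3,\lambda_4>0$ put $$\rho=\sum_{i=1}^4\lambda_i\,(a_i\otimes\phi_i)(a_i\otimes\phi_i)^\dagger .$$ (i) $\rho$ is an entangled three-qubit state of rank four. (ii) If $\lambda_4=1$, then $\rho$ is a three-qubit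 PPTES of rank four if and only if $\lambda_1=|t^2-t|$, $\lambda_2=|t-1|$ and $\lambda_3=|t|$. For these values $$\rho=\begin{pmatrix} |t^2-t|&0&0&|t^2-t|&0&0&0&0\\ 0&|t|+|t|^2&|t|-|t|^2&0&0&|t|+t&|t|-t&0\\ 0&|t|-|t|^2&|t|+|t|^2&0&0&|t|-t&|t|+t&0\\ |t^2-t|&0&0&|t^2-t|&0&0&0&0\\ 0&0&0&0&|t-1|&0&0&-|t-1|\\ 0&|t|+\bar t&|t|-\bar t&0&0&|t|+1&|t|-1&0\\ 0&|t|-\bar t&|t|+\bar t&0&0&|t|-1&|t|+1&0\\ 0&0&0&0&-|t-1|&0&0&|t-1| \end{pmatrix}.$$ (iii) The kernel of $\rho$ is $$\Big\{\Big(a,\,-\tfrac{(|t|^2+t)c+(|t|^2-t)d}{2|t|^2},\,-\tfrac{(|t|^2-t)c+(|t|^2+t)d}{2|t|^2},\,-a,\,b,\,c,\,d,\,b\Big):(a,b,c,d)\in\mathbb C^4\Big\},$$ and it contains no nonzero product vector $x\otimes y\otimes w\in\mathbb C^2\otimes\mathbb C^2\otimes\mathbb C^2$. -/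

import Mathlib

open scoped ComplexOrder Matrix

namespace ThreeQubit

/-- Labels of the computational basis of `ℂ² ⊗ ℂ² ⊗ ℂ²`. -/
abbrev Idx : Type := Fin 2 × Fin 2 × Fin 2

/-- Position of `(j, k)` in the lexicographic order of the basis of `ℂ² ⊗ ℂ² = ℂ⁴`
(counted from `0`). -/
def pos4 (p : Fin 2 × Fin 2) : Fin 4 :=
  ⟨2 * p.1.val + p.2.val, by omega⟩

/-- Position of `(i, j, k)` in the lexicographic order of the basis of `ℂ² ⊗ ℂ² ⊗ ℂ² = ℂ⁸`
(counted from `0`). -/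
def pos8 (p : Idx) : Fin 8 :=
  ⟨4 * p.1.val + 2 * p.2.1.val + p.2.2.val, by omega⟩

/-- The product vector `u ⊗ v ⊗ w`. -/
def tensor3 (u v w : Fin 2 → ℂ) : Idx → ℂ :=
  fun p => u p.1 * v p.2.1 * w p.2.2

/-- The bipartite product `a ⊗ ψ` of `a ∈ ℂ²` and `ψ ∈ ℂ² ⊗ ℂ²`. -/
def tensorABC (a : Fin 2 → ℂ) (ψ : Fin 2 × Fin 2 → ℂ) : Idx → ℂ :=
  fun p => a p.1 * ψ p.2

/-- A (tripartite, nonzero) product vector. -/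
def IsProductVector (x : Idx → ℂ) : Prop :=
  x ≠ 0 ∧ ∃ u v w : Fin 2 → ℂ, x = tensor3 u v w

/-- `z z†`. -/
def ketbra (z : Idx → ℂ) : Matrix Idx Idx ℂ :=
  Matrix.vecMulVec z (star z)

/-- A three-qubit state, not necessarily normalized: a nonzero positive semidefinite matrix. -/
def IsState (ρ : Matrix Idx Idx ℂ) : Prop :=
  ρ.PosSemidef ∧ ρ ≠ 0

/-- (Full) separability: a convex combination of pure product states. As states are not
normalized, neither are the vectors. -/
def IsSeparable (ρ : Matrix Idx Idx ℂ) : Prop :=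
  ∃ (n : ℕ) (p : Fin n → ℝ) (u v w : Fin n → Fin 2 → ℂ),
    (∀ i, 0 ≤ p i) ∧ ∑ i, p i = 1 ∧
      ρ = ∑ i, (p i : ℂ) • ketbra (tensor3 (u i) (v i) (w i))

/-- An entangled state: a state that is not separable. -/
def IsEntangled (ρ : Matrix Idx Idx ℂ) : Prop :=
  IsState ρ ∧ ¬ IsSeparable ρ

/-- Partial transpose with respect to the first qubit. -/
def pt1 (ρ : Matrix Idx Idx ℂ) : Matrix Idx Idx ℂ :=
  Matrix.of fun p q => ρ (q.1, p.2.1, p.2.2) (p.1, q.2.1, q.2.2)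

/-- Partial transpose with respect to the second qubit. -/
def pt2 (ρ : Matrix Idx Idx ℂ) : Matrix Idx Idx ℂ :=
  Matrix.of fun p q => ρ (p.1, q.2.1, p.2.2) (q.1, p.2.1, q.2.2)

/-- Partial transpose with respect to the third qubit. -/
def pt3 (ρ : Matrix Idx Idx ℂ) : Matrix Idx Idx ℂ :=
  Matrix.of fun p q => ρ (p.1, p.2.1, q.2.2) (q.1, q.2.1, p.2.2)

/-- Positive partial transpose across each of the three bipartitions. (The partial transpose
with respect to two qubits is the full transpose of the one with respect to the third, so it is
positive semidefinite at the same time.) -/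
def IsPPT (ρ : Matrix Idx Idx ℂ) : Prop :=
  (pt1 ρ).PosSemidef ∧ (pt2 ρ).PosSemidef ∧ (pt3 ρ).PosSemidef

/-- A PPT entangled state. -/
def IsPPTES (ρ : Matrix Idx Idx ℂ) : Prop :=
  IsPPT ρ ∧ IsEntangled ρ

/-- The vectors `a₁, …, a₄` (columns of the matrix). -/
def aVec (t : ℂ) (i : Fin 4) : Fin 2 → ℂ :=
  fun r => (!![1, 0, 1, t;
               0, 1, 1, 1] : Matrix (Fin 2) (Fin 4) ℂ) r i

/-- The unnormalized Bell vectors `φ₁, …, φ₄` (columns of the matrix). -/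
def bellVec (i : Fin 4) : Fin 2 × Fin 2 → ℂ :=
  fun p => (!![1, 1, 0, 0;
               0, 0, 1, 1;
               0, 0, 1, -1;
               1, -1, 0, 0] : Matrix (Fin 4) (Fin 4) ℂ) (pos4 p) i

/-- `ρ = ∑ᵢ lᵢ (aᵢ ⊗ φᵢ)(aᵢ ⊗ φᵢ)†`. -/
noncomputable def rho (t : ℂ) (l : Fin 4 → ℝ) : Matrix Idx Idx ℂ :=
  ∑ i, (l i : ℂ) • ketbra (tensorABC (aVec t i) (bellVec i))

/-- The explicit `8 × 8` matrix; here `A, B, m` stand for the numbers `|t² - t|, |t - 1|, |t|`. -/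
noncomputable def bellMatrix (t : ℂ) : Matrix (Fin 8) (Fin 8) ℂ :=
  let A : ℂ := (‖t ^ 2 - t‖ : ℝ)
  let B : ℂ := (‖t - 1‖ : ℝ)
  let m : ℂ := (‖t‖ : ℝ)
  let s : ℂ := star t
  !![A, 0, 0, A, 0, 0, 0, 0;
     0, m + m ^ 2, m - m ^ 2, 0, 0, m + t, m - t, 0;
     0, m - m ^ 2, m + m ^ 2, 0, 0, m - t, m + t, 0;
     A, 0, 0, A, 0, 0, 0, 0;
     0, 0, 0, 0, B, 0, 0, -B;
     0, m + s, m - s, 0, 0, m + 1, m - 1, 0;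
     0, m - s, m + s, 0, 0, m - 1, m + 1, 0;
     0, 0, 0, 0, -B, 0, 0, B]

/-- The general element of the kernel, with four free parameters. -/
noncomputable def kernelVec (t a b c d : ℂ) : Fin 8 → ℂ :=
  let N : ℂ := (‖t‖ : ℝ) ^ 2
  ![a, -(((N + t) * c + (N - t) * d) / (2 * N)), -(((N - t) * c + (N + t) * d) / (2 * N)), -a,
    b, c, d, b]

end ThreeQubit

namespace ThreeQubit

open Matrix

/-! The operator is built on the Bell basis, and its kernel is the sum of the lines `aᵢ^⊥ ⊗ φᵢ`.
Since `t ≠ 0, 1`, the `aᵢ` are pairwise independent, so for `u ≠ 0` at most one `⟨aᵢ, u⟩` vanishes.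
A product vector `u ⊗ v ⊗ w` in the kernel would make `v ⊗ w` orthogonal to three Bell vectors,
hence a multiple of the fourth, which is not a product. The same argument applied to `aᵢ^⊥` excludes
product vectors from the range. A separable decomposition uses only product vectors of the range, so
`ρ` is entangled.

For PPT, the Bell vectors are real: transposing qubit 1 only conjugates `t`, and transposing qubits
2 or 3 gives the same matrix. The partial transpose of a Bell projector is a signed combination of
Bell projectors, so `pt2 ρ` splits into four 2×2 blocks (`two_smul_pt2_rho`). Their determinants
have the form `P ± Q` and `-P ± R`; nonnegativity forces `P = Q = R = 0`, which determines the `λᵢ`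
(`coefficients_eq`). At these values the blocks are singular with nonnegative diagonal, hence
positive semidefinite. -/

/-- Entries of `rho` in lexicographic order. -/
lemma rho_eq_submatrix (t : ℂ) (l : Fin 4 → ℝ) :
    rho t l = (!![(l 0 : ℂ), 0, 0, l 0, 0, 0, 0, 0;
      0, l 2 + l 3 * (t * star t), l 2 - l 3 * (t * star t), 0, 0, l 2 + l 3 * t,
        l 2 - l 3 * t, 0;
      0, l 2 - l 3 * (t * star t), l 2 + l 3 * (t * star t), 0, 0, l 2 - l 3 * t,
        l 2 + l 3 * t, 0;
      l 0, 0, 0, l 0, 0, 0, 0, 0;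
      0, 0, 0, 0, l 1, 0, 0, -l 1;
      0, l 2 + l 3 * star t, l 2 - l 3 * star t, 0, 0, l 2 + l 3, l 2 - l 3, 0;
      0, l 2 - l 3 * star t, l 2 + l 3 * star t, 0, 0, l 2 - l 3, l 2 + l 3, 0;
      0, 0, 0, 0, -l 1, 0, 0, l 1] : Matrix (Fin 8) (Fin 8) ℂ).submatrix pos8 pos8 := by
  let z : Fin 4 → Fin 8 → ℂ := ![![1, 0, 0, 1, 0, 0, 0, 0], ![0, 0, 0, 0, 1, 0, 0, -1],
    ![0, 1, 1, 0, 0, 1, 1, 0], ![0, t, -t, 0, 0, 1, -1, 0]]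
  have hz : ∀ i, tensorABC (aVec t i) (bellVec i) = fun p => z i (pos8 p) := by
    intro i
    ext ⟨j, k, m⟩
    fin_cases i <;> fin_cases j <;> fin_cases k <;> fin_cases m <;>
      simp [z, tensorABC, aVec, bellVec, pos4, pos8]
  have h : rho t l = (∑ i, (l i : ℂ) • vecMulVec (z i) (star (z i))).submatrix pos8 pos8 := by
    ext p q
    simp only [rho, ketbra, hz, Matrix.sum_apply, Matrix.smul_apply, submatrix_apply,
      vecMulVec_apply, Pi.star_apply]
  rw [h]
  congr 1
  ext p q
  simp only [Fin.sum_univ_four, Matrix.add_apply, Matrix.smul_apply, vecMulVec_apply,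
    Pi.star_apply, smul_eq_mul]
  fin_cases p <;> fin_cases q <;> simp [z] <;> ring

lemma mul_star_eq_norm_sq (t : ℂ) : t * star t = ((‖t‖ : ℝ) : ℂ) ^ 2 := by
  simpa using Complex.mul_conj' t

lemma rho_eq_bellMatrix (t : ℂ) :
    rho t ![‖t ^ 2 - t‖, ‖t - 1‖, ‖t‖, 1] = (bellMatrix t).submatrix pos8 pos8 := by
  rw [rho_eq_submatrix, mul_star_eq_norm_sq]
  simp [bellMatrix]

lemma rho_mulVec (t : ℂ) (l : Fin 4 → ℝ) (x : Idx → ℂ) :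
    rho t l *ᵥ x = ∑ i, ((l i : ℂ) * (star (tensorABC (aVec t i) (bellVec i)) ⬝ᵥ x)) •
      tensorABC (aVec t i) (bellVec i) := by
  rw [rho, sum_mulVec]
  refine Finset.sum_congr rfl fun i _ => ?_
  rw [smul_mulVec, ketbra, vecMulVec_mulVec]
  ext p
  simp
  ring

/-! ### Positivity, rank and kernel -/

lemma posSemidef_rho (t : ℂ) (l : Fin 4 → ℝ) (hl : ∀ i, 0 < l i) : (rho t l).PosSemidef := by
  refine posSemidef_sum _ fun i _ => ?_
  exact (posSemidef_vecMulVec_self_star _).smul (by exact_mod_cast (hl i).le)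

lemma rank_rho (t : ℂ) (ht0 : t ≠ 0) (l : Fin 4 → ℝ) (hl : ∀ i, 0 < l i) :
    (rho t l).rank = 4 := by
  apply le_antisymm
  · have : rho t l = Matrix.of (fun p i => (l i : ℂ) * tensorABC (aVec t i) (bellVec i) p) *
        Matrix.of (fun i q => star (tensorABC (aVec t i) (bellVec i) q)) := by
      ext p q
      simp [rho, ketbra, Matrix.sum_apply, Matrix.mul_apply, vecMulVec_apply, mul_assoc]
    rw [this]
    exact (rank_mul_le_left _ _).trans ((rank_le_card_width _).trans_eq (Fintype.card_fin 4))
  -- These four coordinates give an invertible principal minor: `φ₁` and `φ₂` contribute one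
  -- diagonal entry each, `φ₃` and `φ₄` a 2×2 block.
  · let f : Fin 4 → Idx := ![(0, 0, 0), (1, 0, 0), (0, 0, 1), (0, 1, 0)]
    have hS : (rho t l).submatrix f f = !![(l 0 : ℂ), 0, 0, 0; 0, l 1, 0, 0;
        0, 0, l 2 + l 3 * (t * star t), l 2 - l 3 * (t * star t);
        0, 0, l 2 - l 3 * (t * star t), l 2 + l 3 * (t * star t)] := by
      rw [rho_eq_submatrix]
      ext i j
      fin_cases i <;> fin_cases j <;> simp [f, pos8]
    have hdet : ((rho t l).submatrix f f).det =
        4 * l 0 * l 1 * l 2 * (l 3 * (t * star t)) := by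
      rw [hS]
      simp [det_succ_row_zero, Fin.sum_univ_succ, Fin.succAbove]
      ring
    have hu : IsUnit ((rho t l).submatrix f f) := by
      rw [isUnit_iff_isUnit_det, hdet, isUnit_iff_ne_zero]
      have := fun i => (hl i).ne'
      simp [this, ht0]
    have h := rank_of_isUnit _ hu
    have h' := rank_submatrix_le (rho t l) f f
    simp at h
    omega

/-- The kernel of `rho` is cut out by orthogonality to the four vectors `aᵢ ⊗ φᵢ`. -/
lemma mem_ker_rho_iff (t : ℂ) (ht0 : t ≠ 0) (l : Fin 4 → ℝ) (hl : ∀ i, 0 < l i) (x : Idx → ℂ) :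
    x ∈ LinearMap.ker (rho t l).mulVecLin ↔
      x (0, 0, 0) + x (0, 1, 1) = 0 ∧ x (1, 0, 0) - x (1, 1, 1) = 0 ∧
      x (0, 0, 1) + x (0, 1, 0) + (x (1, 0, 1) + x (1, 1, 0)) = 0 ∧
      star t * (x (0, 0, 1) - x (0, 1, 0)) + (x (1, 0, 1) - x (1, 1, 0)) = 0 := by
  have hl' : ∀ i, (l i : ℂ) ≠ 0 := fun i => by exact_mod_cast (hl i).ne'
  have hdot : ∀ i, star (tensorABC (aVec t i) (bellVec i)) ⬝ᵥ x =
      ![x (0, 0, 0) + x (0, 1, 1), x (1, 0, 0) - x (1, 1, 1),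
      x (0, 0, 1) + x (0, 1, 0) + (x (1, 0, 1) + x (1, 1, 0)),
      star t * (x (0, 0, 1) - x (0, 1, 0)) + (x (1, 0, 1) - x (1, 1, 0))] i := by
    intro i
    fin_cases i <;>
      simp [dotProduct, Fintype.sum_prod_type, tensorABC, aVec, bellVec, pos4] <;> ring
  rw [LinearMap.mem_ker, mulVecLin_apply, rho_mulVec]
  simp only [hdot, Fin.sum_univ_four]
  constructor
  · intro h
    have h0 := congrFun h (0, 0, 0)
    have h1 := congrFun h (1, 0, 0)
    have h2 := congrFun h (0, 0, 1)
    have h3 := congrFun h (0, 1, 0)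
    simp [tensorABC, aVec, bellVec, pos4, hl'] at h0 h1 h2 h3
    refine ⟨h0, h1, ?_, ?_⟩
    -- The rows `001` and `010` mix `φ₃` and `φ₄`; their sum and difference separate the two
    -- coefficients.
    · apply mul_left_cancel₀ (hl' 2)
      linear_combination (h2 + h3) / 2
    · apply mul_left_cancel₀ (mul_ne_zero (hl' 3) ht0)
      simp only [Complex.star_def]
      linear_combination (h2 - h3) / 2
  · rintro ⟨h0, h1, h2, h3⟩
    simp only [cons_val, h0, h1, h2, h3, mul_zero, zero_smul, add_zero]

lemma mem_ker_rho_iff_exists_kernelVec (t : ℂ) (ht0 : t ≠ 0) (l : Fin 4 → ℝ)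
    (hl : ∀ i, 0 < l i) (x : Idx → ℂ) :
    x ∈ LinearMap.ker (rho t l).mulVecLin ↔
      ∃ a b c d : ℂ, x = fun p => kernelVec t a b c d (pos8 p) := by
  rw [mem_ker_rho_iff t ht0 l hl]
  have hs : star t ≠ 0 := star_ne_zero.mpr ht0
  constructor
  · rintro ⟨h0, h1, h2, h3⟩
    refine ⟨x (0, 0, 0), x (1, 0, 0), x (1, 0, 1), x (1, 1, 0), ?_⟩
    -- Solving the last two equations for `x (0, 0, 1)` and `x (0, 1, 0)` divides by `star t`; the
    -- quotients take the stated form because `|t|² = t * star t`.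
    have key1 : star t * (2 * x (0, 0, 1)) = star t * (-(x (1, 0, 1) + x (1, 1, 0))) -
        (x (1, 0, 1) - x (1, 1, 0)) := by
      linear_combination star t * h2 + h3
    have key2 : star t * (2 * x (0, 1, 0)) = star t * (-(x (1, 0, 1) + x (1, 1, 0))) +
        (x (1, 0, 1) - x (1, 1, 0)) := by
      linear_combination star t * h2 - h3
    ext ⟨i, j, k⟩
    fin_cases i <;> fin_cases j <;> fin_cases k <;>
      simp only [kernelVec, pos8, ← mul_star_eq_norm_sq] <;> simp
    · rw [← Complex.star_def]
      field_simp
      linear_combination key1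
    · rw [← Complex.star_def]
      field_simp
      linear_combination key2
    · linear_combination h0
    · linear_combination -h1
  · rintro ⟨a, b, c, d, rfl⟩
    simp only [kernelVec, pos8, ← mul_star_eq_norm_sq]
    refine ⟨?_, ?_, ?_, ?_⟩ <;> simp <;> rw [← Complex.star_def] <;> field_simp <;> ring

/-! ### Product vectors and entanglement -/

/-- The relation `p * q = r * s` is the rank-one condition on the coordinates of `v ⊗ w`.
Orthogonality to both Bell vectors of one pair kills `r, s`; one more makes `p = ±q`, and then `p² =
0`. -/
lemma eq_zero_of_mul_eq_mul {p q r s : ℂ} (hprod : p * q = r * s) (hadd : r + s = 0)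
    (hsub : r - s = 0) (h : p + q = 0 ∨ p - q = 0) : p = 0 ∧ q = 0 ∧ r = 0 ∧ s = 0 := by
  have hr : r = 0 := by linear_combination (hadd + hsub) / 2
  have hs : s = 0 := by linear_combination (hadd - hsub) / 2
  have hp : p = 0 := by
    rw [hr, zero_mul] at hprod
    rcases h with h | h <;> rw [← mul_self_eq_zero]
    · linear_combination p * h - hprod
    · linear_combination p * h + hprod
  refine ⟨hp, ?_, hr, hs⟩
  rcases h with h | h
  · linear_combination h - hp
  · linear_combination hp - h

/-- A product vector of two qubits is not orthogonal to three Bell vectors. -/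
lemma eq_zero_of_bell_orthogonal {e₀ e₁ e₂ e₃ v₀ v₁ w₀ w₁ : ℂ}
    (h01 : e₀ ≠ 0 ∨ e₁ ≠ 0) (h02 : e₀ ≠ 0 ∨ e₂ ≠ 0) (h03 : e₀ ≠ 0 ∨ e₃ ≠ 0)
    (h12 : e₁ ≠ 0 ∨ e₂ ≠ 0) (h13 : e₁ ≠ 0 ∨ e₃ ≠ 0) (h23 : e₂ ≠ 0 ∨ e₃ ≠ 0)
    (h0 : e₀ * (v₀ * w₀ + v₁ * w₁) = 0) (h1 : e₁ * (v₀ * w₀ - v₁ * w₁) = 0)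
    (h2 : e₂ * (v₀ * w₁ + v₁ * w₀) = 0) (h3 : e₃ * (v₀ * w₁ - v₁ * w₀) = 0) :
    v₀ * w₀ = 0 ∧ v₁ * w₁ = 0 ∧ v₀ * w₁ = 0 ∧ v₁ * w₀ = 0 := by
  -- At most one `eᵢ` vanishes, so one of the pairs `{e₀, e₁}`, `{e₂, e₃}` is nonzero throughout and
  -- the other contains a nonzero member.
  by_cases h : e₀ = 0 ∨ e₁ = 0
  · have h2' : e₂ ≠ 0 := h.elim (fun h => h02.resolve_left (not_not.2 h))
      (fun h => h12.resolve_left (not_not.2 h))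
    have h3' : e₃ ≠ 0 := h.elim (fun h => h03.resolve_left (not_not.2 h))
      (fun h => h13.resolve_left (not_not.2 h))
    exact eq_zero_of_mul_eq_mul (by ring) ((mul_eq_zero.1 h2).resolve_left h2')
      ((mul_eq_zero.1 h3).resolve_left h3')
      (h01.imp (fun h => (mul_eq_zero.1 h0).resolve_left h)
        (fun h => (mul_eq_zero.1 h1).resolve_left h))
  · rw [not_or] at h
    obtain ⟨hr, hs, hp, hq⟩ := eq_zero_of_mul_eq_mul
      (p := v₀ * w₁) (q := v₁ * w₀) (by ring) ((mul_eq_zero.1 h0).resolve_left h.1)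
      ((mul_eq_zero.1 h1).resolve_left h.2)
      (h23.imp (fun h => (mul_eq_zero.1 h2).resolve_left h)
        (fun h => (mul_eq_zero.1 h3).resolve_left h))
    exact ⟨hp, hq, hr, hs⟩

lemma tensor3_eq_zero {u v w : Fin 2 → ℂ}
    (h : v 0 * w 0 = 0 ∧ v 1 * w 1 = 0 ∧ v 0 * w 1 = 0 ∧ v 1 * w 0 = 0) :
    tensor3 u v w = 0 := by
  obtain ⟨h1, h2, h3, h4⟩ := h
  ext ⟨i, j, k⟩
  fin_cases j <;> fin_cases k <;> simp [tensor3, mul_assoc, h1, h2, h3, h4]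

lemma tensor3_eq_zero_of_left {u v w : Fin 2 → ℂ} (h : u 0 = 0 ∧ u 1 = 0) :
    tensor3 u v w = 0 := by
  ext ⟨i, j, k⟩
  fin_cases i <;> simp [tensor3, h.1, h.2]

lemma not_isProductVector_of_mem_ker (t : ℂ) (ht0 : t ≠ 0) (ht1 : t ≠ 1) (l : Fin 4 → ℝ)
    (hl : ∀ i, 0 < l i) (x : Idx → ℂ) (hx : x ∈ LinearMap.ker (rho t l).mulVecLin) :
    ¬ IsProductVector x := by
  rintro ⟨hne, u, v, w, rfl⟩
  obtain ⟨h0, h1, h2, h3⟩ := (mem_ker_rho_iff t ht0 l hl _).1 hx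
  simp only [tensor3] at h0 h1 h2 h3
  have hs : star t ≠ 0 := star_ne_zero.mpr ht0
  have hs1 : star t - 1 ≠ 0 := fun h => ht1 (star_injective (by
    rw [star_one]; exact sub_eq_zero.1 h))
  have hu : u 0 = 0 → u 1 = 0 → False := fun a b => hne (tensor3_eq_zero_of_left ⟨a, b⟩)
  -- Here `eᵢ` is the inner product of `u` with the corresponding `a` vector.
  refine hne (tensor3_eq_zero (eq_zero_of_bell_orthogonal (e₀ := u 0) (e₁ := u 1)
    (e₂ := u 0 + u 1) (e₃ := star t * u 0 + u 1) ?_ ?_ ?_ ?_ ?_ ?_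
    (by linear_combination h0) (by linear_combination h1) (by linear_combination h2)
    (by linear_combination h3))) <;> by_contra! h <;> obtain ⟨h, h'⟩ := h
  · exact hu h h'
  · exact hu h (by linear_combination h' - h)
  · exact hu h (by linear_combination h' - star t * h)
  · exact hu (by linear_combination h' - h) h
  · exact hu (mul_left_cancel₀ hs (by linear_combination h' - h)) h
  · have : u 0 = 0 := mul_left_cancel₀ hs1 (by linear_combination h' - h)
    exact hu this (by linear_combination h - this)

lemma star_dotProduct_ketbra_mulVec (y z : Idx → ℂ) :
    star y ⬝ᵥ (ketbra z *ᵥ y) = ((‖star y ⬝ᵥ z‖ ^ 2 : ℝ) : ℂ) := by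
  have h : star z ⬝ᵥ y = star (star y ⬝ᵥ z) := by
    rw [star_dotProduct]
  rw [ketbra, vecMulVec_mulVec, h]
  push_cast
  rw [← mul_star_eq_norm_sq]
  simp [dotProduct_smul, mul_comm]

/-- The product vectors of a separable decomposition are orthogonal to the kernel. -/
lemma orthogonal_of_sum_ketbra_mulVec_eq_zero {n : ℕ} {p : Fin n → ℝ} {z : Fin n → Idx → ℂ}
    (hp : ∀ i, 0 ≤ p i) {y : Idx → ℂ} (hy : (∑ i, (p i : ℂ) • ketbra (z i)) *ᵥ y = 0)
    {i : Fin n} (hi : p i ≠ 0) : star y ⬝ᵥ z i = 0 := by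
  have h : ((∑ i, p i * ‖star y ⬝ᵥ z i‖ ^ 2 : ℝ) : ℂ) = 0 := by
    have h := congrArg (star y ⬝ᵥ ·) hy
    simp only [dotProduct_zero, sum_mulVec, dotProduct_sum, smul_mulVec, dotProduct_smul,
      star_dotProduct_ketbra_mulVec] at h
    rw [← h]
    simp
  rw [Complex.ofReal_eq_zero, Finset.sum_eq_zero_iff_of_nonneg
    (fun i _ => mul_nonneg (hp i) (sq_nonneg _))] at h
  simpa [hi] using h i (Finset.mem_univ i)

lemma not_isSeparable_rho (t : ℂ) (ht0 : t ≠ 0) (ht1 : t ≠ 1) (l : Fin 4 → ℝ)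
    (hl : ∀ i, 0 < l i) : ¬ IsSeparable (rho t l) := by
  rintro ⟨n, p, u, v, w, hp, -, hρ⟩
  have hker : ∀ y : Fin 8 → ℂ, y 0 + y 3 = 0 → y 4 - y 7 = 0 →
      y 1 + y 2 + (y 5 + y 6) = 0 → star t * (y 1 - y 2) + (y 5 - y 6) = 0 →
      ∀ i, p i ≠ 0 → star (fun q => y (pos8 q)) ⬝ᵥ tensor3 (u i) (v i) (w i) = 0 := by
    intro y h0 h1 h2 h3 i hi
    refine orthogonal_of_sum_ketbra_mulVec_eq_zero
      (z := fun i => tensor3 (u i) (v i) (w i)) hp ?_ hi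
    rw [← hρ]
    exact (mem_ker_rho_iff t ht0 l hl fun q => y (pos8 q)).2 ⟨h0, h1, h2, h3⟩
  have hz : ∀ i, p i ≠ 0 → tensor3 (u i) (v i) (w i) = 0 := by
    intro i hi
    by_contra hne
    -- The four test vectors span the lines `aᵢ^⊥ ⊗ φᵢ`, taken in the order `φ₂, φ₁, φ₃, φ₄`. Below,
    -- `eᵢ` vanishes exactly when `u i` is proportional to the corresponding `a` vector.
    have h0 := hker ![1, 0, 0, -1, 0, 0, 0, 0] (by simp) (by simp) (by simp) (by simp) i hi
    have h1 := hker ![0, 0, 0, 0, 1, 0, 0, 1] (by simp) (by simp) (by simp) (by simp) i hi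
    have h2 := hker ![0, 1, 1, 0, 0, -1, -1, 0] (by simp) (by simp) (by simp) (by simp) i hi
    have h3 := hker ![0, 1, -1, 0, 0, -star t, star t, 0] (by simp) (by simp) (by simp)
      (by simp; ring) i hi
    simp [dotProduct, Fintype.sum_prod_type, pos8, tensor3] at h0 h1 h2 h3
    have ht1' : t - 1 ≠ 0 := sub_ne_zero.2 ht1
    have hu : u i 0 = 0 → u i 1 = 0 → False := fun a b => hne (tensor3_eq_zero_of_left ⟨a, b⟩)
    refine hne (tensor3_eq_zero (eq_zero_of_bell_orthogonal (e₀ := u i 1) (e₁ := u i 0)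
      (e₂ := u i 0 - u i 1) (e₃ := u i 0 - t * u i 1) ?_ ?_ ?_ ?_ ?_ ?_
      (by linear_combination h1) (by linear_combination h0) (by linear_combination h2)
      (by linear_combination h3))) <;> by_contra! h <;> obtain ⟨h, h'⟩ := h
    · exact hu h' h
    · exact hu (by linear_combination h' + h) h
    · exact hu (by linear_combination h' + t * h) h
    · exact hu h (by linear_combination h - h')
    · exact hu h (mul_left_cancel₀ ht0 (by linear_combination h - h'))
    · have : u i 1 = 0 := mul_left_cancel₀ ht1' (by linear_combination h - h')
      exact hu (by linear_combination h + this) this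
  have hzero : rho t l = 0 := by
    rw [hρ]
    refine Finset.sum_eq_zero fun i _ => ?_
    by_cases hi : p i = 0
    · simp [hi]
    · simp [hz i hi, ketbra]
  have := rank_rho t ht0 l hl
  rw [hzero, rank_zero] at this
  omega

lemma isEntangled_rho (t : ℂ) (ht0 : t ≠ 0) (ht1 : t ≠ 1) (l : Fin 4 → ℝ)
    (hl : ∀ i, 0 < l i) : IsEntangled (rho t l) := by
  refine ⟨⟨posSemidef_rho t l hl, fun h => ?_⟩, not_isSeparable_rho t ht0 ht1 l hl⟩
  have := rank_rho t ht0 l hl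
  rw [h, rank_zero] at this
  omega

/-! ### Partial transposes and their block decomposition -/

lemma rho_apply (t : ℂ) (l : Fin 4 → ℝ) (p q : Idx) :
    rho t l p q = ∑ i, l i * (aVec t i p.1 * bellVec i p.2 *
      (star (aVec t i q.1) * bellVec i q.2)) := by
  have hb : ∀ i q, star (bellVec i q) = bellVec i q := by
    rintro i ⟨j, k⟩
    fin_cases i <;> fin_cases j <;> fin_cases k <;> simp [bellVec, pos4]
  simp only [rho, ketbra, Matrix.sum_apply, Matrix.smul_apply, vecMulVec_apply, tensorABC,
    Pi.star_apply, star_mul', hb, smul_eq_mul]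

lemma aVec_star (t : ℂ) (i : Fin 4) (r : Fin 2) : aVec (star t) i r = star (aVec t i r) := by
  fin_cases i <;> fin_cases r <;> simp [aVec]

lemma pt1_rho (t : ℂ) (l : Fin 4 → ℝ) : pt1 (rho t l) = rho (star t) l := by
  ext p q
  simp only [pt1, of_apply, rho_apply, aVec_star, star_star]
  exact Finset.sum_congr rfl fun i _ => by ring

/-- The two sides differ by transposing qubits 2 and 3 together, which fixes each real symmetric
`φᵢφᵢ†`. -/
lemma pt3_rho (t : ℂ) (l : Fin 4 → ℝ) : pt3 (rho t l) = pt2 (rho t l) := by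
  ext p q
  simp only [pt2, pt3, of_apply, rho_apply]
  exact Finset.sum_congr rfl fun i _ => by ring

/-- The map `e ↦ e ⊗ χ` for a vector `χ` of two qubits. -/
def tensorMap (χ : Matrix (Fin 2) (Fin 2) ℂ) : Matrix Idx (Fin 2) ℂ :=
  Matrix.of fun p r => if p.1 = r then χ p.2.1 p.2.2 else 0

lemma tensorMap_mul_mul_apply (χ M : Matrix (Fin 2) (Fin 2) ℂ) (p q : Idx) :
    (tensorMap χ * M * (tensorMap χ)ᴴ) p q =
      χ p.2.1 p.2.2 * M p.1 q.1 * star (χ q.2.1 q.2.2) := by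
  simp [tensorMap, Matrix.mul_apply, apply_ite star]

/-- The map `e ↦ e ⊗ (|00⟩ + s|11⟩)`. -/
def evenEmb (s : ℂ) : Matrix Idx (Fin 2) ℂ := tensorMap !![1, 0; 0, s]

/-- The map `e ↦ e ⊗ (|01⟩ + s|10⟩)`. -/
def oddEmb (s : ℂ) : Matrix Idx (Fin 2) ℂ := tensorMap !![0, 1; s, 0]

/-- Blocks of the partial transpose on the even sector. -/
def evenBlock (t : ℂ) (a b c s : ℝ) : Matrix (Fin 2) (Fin 2) ℂ :=
  !![a + s * (c - t * star t), s * (c - t); s * (c - star t), b + s * (c - 1)]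

/-- Blocks of the partial transpose on the odd sector. -/
def oddBlock (t : ℂ) (a b c s : ℝ) : Matrix (Fin 2) (Fin 2) ℂ :=
  !![c + t * star t + s * a, c + t; c + star t, c + 1 - s * b]

lemma evenBlock_apply (t : ℂ) (a b c s : ℝ) (i j : Fin 2) :
    evenBlock t a b c s i j = a * (aVec t 0 i * star (aVec t 0 j)) +
      b * (aVec t 1 i * star (aVec t 1 j)) + s * (c * (aVec t 2 i * star (aVec t 2 j)) -
      aVec t 3 i * star (aVec t 3 j)) := by
  fin_cases i <;> fin_cases j <;> simp [evenBlock, aVec]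

lemma oddBlock_apply (t : ℂ) (a b c s : ℝ) (i j : Fin 2) :
    oddBlock t a b c s i j = c * (aVec t 2 i * star (aVec t 2 j)) +
      aVec t 3 i * star (aVec t 3 j) + s * (a * (aVec t 0 i * star (aVec t 0 j)) -
      b * (aVec t 1 i * star (aVec t 1 j))) := by
  fin_cases i <;> fin_cases j <;> simp [oddBlock, aVec]; ring

lemma two_smul_pt2_rho (t : ℂ) (l : Fin 4 → ℝ) (h3 : l 3 = 1) :
    (2 : ℂ) • pt2 (rho t l) =
      evenEmb 1 * evenBlock t (l 0) (l 1) (l 2) 1 * (evenEmb 1)ᴴ +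
      evenEmb (-1) * evenBlock t (l 0) (l 1) (l 2) (-1) * (evenEmb (-1))ᴴ +
      oddEmb 1 * oddBlock t (l 0) (l 1) (l 2) 1 * (oddEmb 1)ᴴ +
      oddEmb (-1) * oddBlock t (l 0) (l 1) (l 2) (-1) * (oddEmb (-1))ᴴ := by
  ext ⟨i, j, k⟩ ⟨i', j', k'⟩
  simp only [Matrix.add_apply, Matrix.smul_apply, evenEmb, oddEmb, tensorMap_mul_mul_apply, pt2,
    of_apply, rho_apply, evenBlock_apply, oddBlock_apply, Fin.sum_univ_four, h3, smul_eq_mul]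
  -- Only the Bell vectors matter here: the identity holds for arbitrary vectors in place of the
  -- `aᵢ`.
  generalize aVec t = A
  fin_cases j <;> fin_cases k <;> fin_cases j' <;> fin_cases k' <;>
    simp [bellVec, pos4] <;> ring

/-- Compression isolates a single block, since the Bell vectors are mutually orthogonal; the factor
2 comes from their squared norm. This gives necessity of positivity of each block. -/
lemma evenEmb_compress_pt2_rho (t : ℂ) (l : Fin 4 → ℝ) (h3 : l 3 = 1) (s : ℝ)
    (hs : s * s = 1) :
    (evenEmb s)ᴴ * pt2 (rho t l) * evenEmb s =
      (2 : ℂ) • evenBlock t (l 0) (l 1) (l 2) s := by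
  have hs' : (s : ℂ) * s = 1 := by exact_mod_cast hs
  rw [rho_eq_submatrix, h3]
  ext i j
  fin_cases i <;> fin_cases j <;>
    simp [pt2, pos8, evenEmb, tensorMap, evenBlock, Matrix.mul_apply, Fintype.sum_prod_type]
  · linear_combination (l 0 : ℂ) * hs'
  · ring
  · ring
  · linear_combination (l 1 : ℂ) * hs'

lemma oddEmb_compress_pt2_rho (t : ℂ) (l : Fin 4 → ℝ) (h3 : l 3 = 1) (s : ℝ)
    (hs : s * s = 1) :
    (oddEmb s)ᴴ * pt2 (rho t l) * oddEmb s =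
      (2 : ℂ) • oddBlock t (l 0) (l 1) (l 2) s := by
  have hs' : (s : ℂ) * s = 1 := by exact_mod_cast hs
  rw [rho_eq_submatrix, h3]
  ext i j
  fin_cases i <;> fin_cases j <;>
    simp [pt2, pos8, oddEmb, tensorMap, oddBlock, Matrix.mul_apply, Fintype.sum_prod_type]
  · linear_combination ((l 2 : ℂ) + t * starRingEnd ℂ t) * hs'
  · linear_combination ((l 2 : ℂ) + t) * hs'
  · linear_combination ((l 2 : ℂ) + starRingEnd ℂ t) * hs'
  · linear_combination ((l 2 : ℂ) + 1) * hs'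

/-! ### Positivity of the 2×2 blocks -/

lemma posSemidef_fin_two {α γ : ℝ} {β : ℂ} (hα : 0 ≤ α) (hγ : 0 ≤ γ) (h : ‖β‖ ^ 2 = α * γ) :
    (!![(α : ℂ), β; star β, γ] : Matrix (Fin 2) (Fin 2) ℂ).PosSemidef := by
  have hβ : β * star β = α * γ := by rw [mul_star_eq_norm_sq]; exact_mod_cast h
  rcases hα.eq_or_lt with rfl | hα
  · have : β = 0 := by simpa using h
    subst this
    have : (!![((0 : ℝ) : ℂ), 0; star 0, γ] : Matrix (Fin 2) (Fin 2) ℂ) =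
        diagonal ![0, (γ : ℂ)] := by
      ext i j; fin_cases i <;> fin_cases j <;> simp
    rw [this]
    refine PosSemidef.diagonal fun i => ?_
    fin_cases i <;> simp [hγ]
  -- A singular matrix with `α > 0` is `α⁻¹ v v†`, where `v` is its first column.
  · have hα' : (α : ℂ) ≠ 0 := by exact_mod_cast hα.ne'
    have : (!![(α : ℂ), β; star β, γ] : Matrix (Fin 2) (Fin 2) ℂ) =
        ((α⁻¹ : ℝ) : ℂ) • vecMulVec ![(α : ℂ), star β] (star ![(α : ℂ), star β]) := by
      ext i j
      rw [Matrix.smul_apply, vecMulVec_apply]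
      fin_cases i <;> fin_cases j <;> simp <;> field_simp
      rw [← Complex.star_def]
      linear_combination -hβ
    rw [this]
    exact (posSemidef_vecMulVec_self_star _).smul (by exact_mod_cast (inv_pos.2 hα).le)

lemma norm_ofReal_add_sq (c : ℝ) (t : ℂ) :
    ‖(c : ℂ) + t‖ ^ 2 = c ^ 2 + 2 * c * t.re + ‖t‖ ^ 2 := by
  rw [← Complex.normSq_eq_norm_sq, ← Complex.normSq_eq_norm_sq, Complex.normSq_apply,
    Complex.normSq_apply]
  simp
  ring

lemma norm_sub_one_sq (t : ℂ) : ‖t - 1‖ ^ 2 = 1 - 2 * t.re + ‖t‖ ^ 2 := by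
  have := norm_ofReal_add_sq (-1) t
  rw [show ((-1 : ℝ) : ℂ) + t = t - 1 by push_cast; ring] at this
  rw [this]; ring

lemma det_evenBlock (t : ℂ) (a b c s : ℝ) (hs : s * s = 1) :
    (evenBlock t a b c s).det =
      ((a * b + s * (a * (c - 1) + b * (c - ‖t‖ ^ 2)) - c * ‖t - 1‖ ^ 2 : ℝ) : ℂ) := by
  have hs' : (s : ℂ) * s = 1 := by exact_mod_cast hs
  have hr : t + star t = 2 * (t.re : ℂ) := by
    simpa using Complex.add_conj t
  rw [norm_sub_one_sq, evenBlock, det_fin_two_of]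
  push_cast
  rw [← mul_star_eq_norm_sq]
  linear_combination (c * (t + star t) - c - c * (t * star t)) * hs' + c * hr

lemma det_oddBlock (t : ℂ) (a b c s : ℝ) (hs : s * s = 1) :
    (oddBlock t a b c s).det =
      ((c * ‖t - 1‖ ^ 2 - a * b + s * (a * (c + 1) - b * (c + ‖t‖ ^ 2)) : ℝ) : ℂ) := by
  have hs' : (s : ℂ) * s = 1 := by exact_mod_cast hs
  have hr : t + star t = 2 * (t.re : ℂ) := by
    simpa using Complex.add_conj t
  rw [norm_sub_one_sq, oddBlock, det_fin_two_of]
  push_cast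
  rw [← mul_star_eq_norm_sq]
  linear_combination (-(a : ℂ) * b) * hs' - c * hr

/-- The determinant conditions for positivity of the blocks determine the coefficients. -/
lemma coefficients_eq {a b c m k : ℝ} (hb : 0 < b) (hc : 0 < c) (hm : 0 < m)
    (hk : 0 ≤ k)
    (h1 : 0 ≤ a * b + 1 * (a * (c - 1) + b * (c - m ^ 2)) - c * k ^ 2)
    (h2 : 0 ≤ a * b + -1 * (a * (c - 1) + b * (c - m ^ 2)) - c * k ^ 2)
    (h3 : 0 ≤ c * k ^ 2 - a * b + 1 * (a * (c + 1) - b * (c + m ^ 2)))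
    (h4 : 0 ≤ c * k ^ 2 - a * b + -1 * (a * (c + 1) - b * (c + m ^ 2))) :
    a = m * k ∧ b = k ∧ c = m := by
  -- Adding `h1` and `h2` gives `a * b ≥ c * k ^ 2`, adding `h3` and `h4` the reverse. Each pair
  -- then bounds a quantity and its negative by zero.
  have e1 : a * b = c * k ^ 2 := by linarith
  have e2 : a * (c - 1) + b * (c - m ^ 2) = 0 := by linarith
  have e3 : a * (c + 1) = b * (c + m ^ 2) := by linarith
  have e4 : a = b * c := by linarith
  have e5 : c = m := by
    have : b * (c ^ 2) = b * m ^ 2 := by rw [e4] at e2; linarith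
    exact (pow_left_inj₀ hc.le hm.le two_ne_zero).1 (mul_left_cancel₀ hb.ne' this)
  have e6 : b = k := by
    have : c * b ^ 2 = c * k ^ 2 := by rw [e4] at e1; linarith
    exact (pow_left_inj₀ hb.le hk two_ne_zero).1 (mul_left_cancel₀ hc.ne' this)
  refine ⟨?_, e6, e5⟩
  rw [e4, e5, e6, mul_comm]

lemma norm_sq_sub_self (t : ℂ) : ‖t ^ 2 - t‖ = ‖t‖ * ‖t - 1‖ := by
  rw [← norm_mul]; ring_nf

lemma eq_of_posSemidef_pt2 (t : ℂ) (ht0 : t ≠ 0) (l : Fin 4 → ℝ) (hl : ∀ i, 0 < l i)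
    (h3 : l 3 = 1) (h : (pt2 (rho t l)).PosSemidef) :
    l 0 = ‖t ^ 2 - t‖ ∧ l 1 = ‖t - 1‖ ∧ l 2 = ‖t‖ := by
  have half : ∀ {M : Matrix (Fin 2) (Fin 2) ℂ}, ((2 : ℂ) • M).PosSemidef → 0 ≤ M.det := by
    intro M hM
    have h0 : (0 : ℂ) ≤ 2⁻¹ := by
      rw [show (2⁻¹ : ℂ) = ((2⁻¹ : ℝ) : ℂ) by push_cast; rfl]
      exact_mod_cast (by norm_num : (0 : ℝ) ≤ 2⁻¹)
    have := (hM.smul h0).det_nonneg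
    rwa [smul_smul, inv_mul_cancel₀ two_ne_zero, one_smul] at this
  have he : ∀ s : ℝ, s * s = 1 → 0 ≤ (evenBlock t (l 0) (l 1) (l 2) s).det := fun s hs => by
    apply half
    rw [← evenEmb_compress_pt2_rho t l h3 s hs]
    exact h.conjTranspose_mul_mul_same _
  have ho : ∀ s : ℝ, s * s = 1 → 0 ≤ (oddBlock t (l 0) (l 1) (l 2) s).det := fun s hs => by
    apply half
    rw [← oddEmb_compress_pt2_rho t l h3 s hs]
    exact h.conjTranspose_mul_mul_same _
  have h1 := he 1 (by norm_num)
  have h2 := he (-1) (by norm_num)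
  have h4 := ho 1 (by norm_num)
  have h5 := ho (-1) (by norm_num)
  rw [det_evenBlock _ _ _ _ _ (by norm_num), Complex.zero_le_real] at h1 h2
  rw [det_oddBlock _ _ _ _ _ (by norm_num), Complex.zero_le_real] at h4 h5
  rw [norm_sq_sub_self]
  exact coefficients_eq (hl 1) (hl 2) (norm_pos_iff.2 ht0) (norm_nonneg _) h1 h2 h4 h5

lemma posSemidef_evenBlock (t : ℂ) (s : ℝ) (hs : s = 1 ∨ s = -1) :
    (evenBlock t (‖t‖ * ‖t - 1‖) ‖t - 1‖ ‖t‖ s).PosSemidef := by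
  -- The reverse triangle inequality makes both diagonal entries nonnegative for either sign `s`.
  have hα : |‖t‖ - 1| ≤ ‖t - 1‖ := by simpa using abs_norm_sub_norm_le t 1
  obtain ⟨hα1, hα2⟩ := abs_le.1 hα
  have hm := norm_nonneg t
  have hn := norm_ofReal_add_sq (-‖t‖) t
  have hk := norm_sub_one_sq t
  have key : evenBlock t (‖t‖ * ‖t - 1‖) ‖t - 1‖ ‖t‖ s =
      !![((‖t‖ * (‖t - 1‖ + s * (1 - ‖t‖)) : ℝ) : ℂ), s * (‖t‖ - t);
        star (s * (‖t‖ - t)), ((‖t - 1‖ + s * (‖t‖ - 1) : ℝ) : ℂ)] := by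
    rw [evenBlock, mul_star_eq_norm_sq]
    ext i j
    fin_cases i <;> fin_cases j <;> simp; ring
  have hnorm : ‖(s : ℂ) * (‖t‖ - t)‖ ^ 2 = ‖((-‖t‖ : ℝ) : ℂ) + t‖ ^ 2 := by
    have : ((-‖t‖ : ℝ) : ℂ) + t = -(‖t‖ - t) := by push_cast; ring
    rw [this, norm_neg, norm_mul]
    rcases hs with rfl | rfl <;> simp
  rw [key]
  apply posSemidef_fin_two
  · apply mul_nonneg hm
    rcases hs with rfl | rfl <;> linarith
  · rcases hs with rfl | rfl <;> linarith
  · rw [hnorm, hn]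
    have hs2 : s * s = 1 := by rcases hs with rfl | rfl <;> norm_num
    linear_combination (‖t‖ * (1 - ‖t‖) ^ 2) * hs2 - ‖t‖ * hk

lemma posSemidef_oddBlock (t : ℂ) (s : ℝ) (hs : s = 1 ∨ s = -1) :
    (oddBlock t (‖t‖ * ‖t - 1‖) ‖t - 1‖ ‖t‖ s).PosSemidef := by
  have hα : ‖t - 1‖ ≤ ‖t‖ + 1 := by simpa using norm_sub_le t 1
  have hm := norm_nonneg t
  have hk0 := norm_nonneg (t - 1)
  have hn := norm_ofReal_add_sq ‖t‖ t
  have hk := norm_sub_one_sq t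
  have key : oddBlock t (‖t‖ * ‖t - 1‖) ‖t - 1‖ ‖t‖ s =
      !![((‖t‖ * (1 + ‖t‖ + s * ‖t - 1‖) : ℝ) : ℂ), ‖t‖ + t;
        star ((‖t‖ : ℂ) + t), ((‖t‖ + 1 - s * ‖t - 1‖ : ℝ) : ℂ)] := by
    rw [oddBlock, mul_star_eq_norm_sq]
    ext i j
    fin_cases i <;> fin_cases j <;> simp
    ring
  rw [key]
  apply posSemidef_fin_two
  · apply mul_nonneg hm
    rcases hs with rfl | rfl <;> linarith
  · rcases hs with rfl | rfl <;> linarith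
  · rw [hn]
    have hs2 : s * s = 1 := by rcases hs with rfl | rfl <;> norm_num
    linear_combination (‖t‖ * ‖t - 1‖ ^ 2) * hs2 + ‖t‖ * hk

lemma posSemidef_pt2_rho (t : ℂ) (l : Fin 4 → ℝ) (h0 : l 0 = ‖t ^ 2 - t‖)
    (h1 : l 1 = ‖t - 1‖) (h2 : l 2 = ‖t‖) (h3 : l 3 = 1) : (pt2 (rho t l)).PosSemidef := by
  have hc : (0 : ℂ) ≤ 2⁻¹ := by
    rw [show (2⁻¹ : ℂ) = ((2⁻¹ : ℝ) : ℂ) by push_cast; rfl]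
    exact_mod_cast (by norm_num : (0 : ℝ) ≤ 2⁻¹)
  have h := two_smul_pt2_rho t l h3
  rw [h0, h1, h2, norm_sq_sub_self] at h
  have hpos : ((2 : ℂ) • pt2 (rho t l)).PosSemidef := by
    rw [h]
    exact ((((posSemidef_evenBlock t 1 (.inl rfl)).mul_mul_conjTranspose_same _).add
      ((posSemidef_evenBlock t (-1) (.inr rfl)).mul_mul_conjTranspose_same _)).add
      ((posSemidef_oddBlock t 1 (.inl rfl)).mul_mul_conjTranspose_same _)).add
      ((posSemidef_oddBlock t (-1) (.inr rfl)).mul_mul_conjTranspose_same _)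
  have := hpos.smul hc
  rwa [smul_smul, inv_mul_cancel₀ two_ne_zero, one_smul] at this

end ThreeQubit

theorem mainTheorem5 (t : ℂ) (ht0 : t ≠ 0) (ht1 : t ≠ 1) :
    (∀ l : Fin 4 → ℝ, (∀ i, 0 < l i) →
      (ThreeQubit.rho t l).rank = 4 ∧
      ThreeQubit.IsEntangled (ThreeQubit.rho t l) ∧
      (l 3 = 1 →
        ((ThreeQubit.IsPPTES (ThreeQubit.rho t l) ∧ (ThreeQubit.rho t l).rank = 4) ↔
          (l 0 = ‖t ^ 2 - t‖ ∧ l 1 = ‖t - 1‖ ∧ l 2 = ‖t‖))) ∧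
      (∀ x : ThreeQubit.Idx → ℂ, x ∈ LinearMap.ker (ThreeQubit.rho t l).mulVecLin ↔
        ∃ a b c d : ℂ, x = fun p => ThreeQubit.kernelVec t a b c d (ThreeQubit.pos8 p)) ∧
      (∀ x ∈ LinearMap.ker (ThreeQubit.rho t l).mulVecLin, ¬ ThreeQubit.IsProductVector x)) ∧
    ThreeQubit.rho t ![‖t ^ 2 - t‖, ‖t - 1‖, ‖t‖, 1] =
      (ThreeQubit.bellMatrix t).submatrix ThreeQubit.pos8 ThreeQubit.pos8 := by
  refine ⟨fun l hl => ⟨ThreeQubit.rank_rho t ht0 l hl, ThreeQubit.isEntangled_rho t ht0 ht1 l hl,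
    fun h3 => ⟨?_, ?_⟩, ThreeQubit.mem_ker_rho_iff_exists_kernelVec t ht0 l hl,
    ThreeQubit.not_isProductVector_of_mem_ker t ht0 ht1 l hl⟩, ThreeQubit.rho_eq_bellMatrix t⟩
  · rintro ⟨⟨⟨-, h, -⟩, -⟩, -⟩
    exact ThreeQubit.eq_of_posSemidef_pt2 t ht0 l hl h3 h
  · rintro ⟨h0, h1, h2⟩
    have h := ThreeQubit.posSemidef_pt2_rho t l h0 h1 h2 h3
    refine ⟨⟨⟨?_, h, ?_⟩, ThreeQubit.isEntangled_rho t ht0 ht1 l hl⟩,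
      ThreeQubit.rank_rho t ht0 l hl⟩
    · rw [ThreeQubit.pt1_rho]
      exact ThreeQubit.posSemidef_rho (star t) l hl
    · rwa [ThreeQubit.pt3_rho]
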